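/- For a finite group $G$ let $\mathcal S(G)\subseteq\mathbb Z$ be the set of all integer group determinants of $G$, i.e. of all values $\det\big(x_{gh^{-1}}\big)_{g,h\in G}$ with $x_g\in\mathbb Z$ for every $g\in G$. Let $Q_{12}=\langle a,b \mid a^6=1,\ b^2=a^3,\ ab=ba^{-1}\rangle$ be the dicyclic group of order $12$. Then $\mathcal S(Q_{12})$ consists exactly of $0$ and the integers of one of the following three forms, where $m$ denotes an arbitrary (positive or negative) integer coprime to $6$ and $a,b$ are non-negative integers: 1. $2^a3^bm$ with ($a=0$, $a=4$ or $a\ge 6$) and ($b=0$ or $b\ge 3$); 2. $2^5 3^b m$ with $b=4$ or $b\ge 6$; 3. $2^5 3^b m k$ with $b\in\{0,3,5\}$, where $k$ is either a prime $p\equiv 5\pmod{12}$ or the square $p^2$ of a prime $p\equiv 5\pmod 6$. -/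

import Mathlib

/-- The group determinant of a finite group `G` at the values `x g` (`g ∈ G`):
the determinant of the `G × G` matrix whose `(g, h)` entry is `x (g * h⁻¹)`. -/
def groupDet (G : Type*) [Group G] [Fintype G] [DecidableEq G] {R : Type*} [CommRing R]
    (x : G → R) : R :=
  Matrix.det (Matrix.of fun g h : G => x (g * h⁻¹))

/-- The set `S(G)` of all values taken by the group determinant of `G` at integer arguments. -/
def integerGroupDets (G : Type*) [Group G] [Fintype G] [DecidableEq G] : Set ℤ :=
  Set.range fun x : G → ℤ => groupDet G x

/-!
For `F = f(a) + b g(a)` in `ℤ[Q₁₂]` the group determinant factors over the irreducible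
representations of `Q₁₂` as `A · B · C² · D²`, where, with `ω` a primitive cube root of unity and `N`
the Eisenstein norm,

* `A = f(1)² - g(1)²` and `B = f(-1)² + g(-1)²`,
* `C = N(f(ω)) - N(g(ω))` and `D = N(f(-ω)) + N(g(-ω))`

(`groupDet_eq`, `det_twistedMatrix`). A quadruple `(f(1), f(-1), f(ω), f(-ω))` occurs exactly when its
entries satisfy the evident congruences modulo `2` and modulo `1 - ω`, so the problem becomes one
about integers (`mem_dets_iff`).

**Restrictions.** Modulo `2`, `A ≡ B` and `C ≡ D`; modulo `3`, `A ≡ C` and `B ≡ D`. Since `A` is a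
difference and `B` a sum of two squares, these congruences force `2⁴` as soon as the determinant is even and `3³` as soon as it
is divisible by `3` (`two_adic`, `three_adic`). If the power of `2` is exactly `2⁵`, then `D` is odd
and `B` is `2` or `8` times an odd number `B'`. If moreover the power of `3` is `3⁰`, `3³` or `3⁵`,
then `3 ∤ B D`, so `B ≡ D` gives `2 B' ≡ D` modulo `3`, and one of `B'`, `D` is `2` modulo `3`. It
therefore has a prime factor `p ≡ 5` modulo `6`. If `p ∣ D`, then `p²` divides the determinant. If
`p ∣ B'`, then either `p ≡ 5` modulo `12`, or `p ≡ 3` modulo `4` and `p²` divides the sum of two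
squares `B` (`exists_prime_factor`).

**Constructions.** The set of determinants is closed under multiplication, so it is enough to attain
the numbers coprime to `6`, a few powers of `2` and `3`, the numbers `2⁵3⁴` and `2⁵3⁶`, and `2⁵p` or
`2⁵p²` for the special primes. For `2⁵p` one writes `p = r² + s²` and takes `B = 2p`. For `2⁵p²` one
takes `D = p`, which requires `p` to be a sum of two Eisenstein norms; this is proved by reducing a
unimodular Hermitian form over the Eisenstein integers (`exists_hermitian_gram`).
-/

/-! ### The group determinant as a product -/

open Matrix in
theorem det_fromBlocks_symm {n R : Type*} [Fintype n] [DecidableEq n] [CommRing R]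
    (A B : Matrix n n R) : (fromBlocks A B B A).det = (A + B).det * (A - B).det := by
  have h : fromBlocks 1 1 0 1 * fromBlocks A B B A * fromBlocks 1 (-1) 0 1
      = fromBlocks (A + B) 0 B (A - B) := by
    simp only [fromBlocks_multiply, fromBlocks_inj]
    refine ⟨?_, ?_, ?_, ?_⟩ <;> simp <;> abel
  have h' := congrArg det h
  simpa [det_fromBlocks_zero₁₂, det_fromBlocks_zero₂₁] using h'

/-- The norm of `x + yω` in the Eisenstein integers, where `ω² + ω + 1 = 0`. -/
def eisNorm (x y : ℤ) : ℤ := x ^ 2 - x * y + y ^ 2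

/-- The action of `f + b g`, with `f, g` in the group ring of the subgroup `{1, a², a⁴}`, on either
eigenspace of the central involution `a³`: the sign `e` is the eigenvalue of `b² = a³`. The diagonal
blocks are the circulant matrix of `f` and its transpose. -/
def twistedMatrix (e f₀ f₁ f₂ g₀ g₁ g₂ : ℤ) : Matrix (Fin 6) (Fin 6) ℤ :=
  !![f₀, f₂, f₁, e * g₀, e * g₁, e * g₂;
     f₁, f₀, f₂, e * g₂, e * g₀, e * g₁;
     f₂, f₁, f₀, e * g₁, e * g₂, e * g₀;
     g₀, g₂, g₁, f₀, f₁, f₂;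
     g₁, g₀, g₂, f₂, f₀, f₁;
     g₂, g₁, g₀, f₁, f₂, f₀]

/-- The invariant vectors and the vectors with coordinate sum zero under the cyclic group of order `3`
span a sublattice of index `9`, on which the matrix is block diagonal with blocks of size `2` and
`4`. -/
theorem det_twistedMatrix (e f₀ f₁ f₂ g₀ g₁ g₂ : ℤ) :
    (twistedMatrix e f₀ f₁ f₂ g₀ g₁ g₂).det =
      ((f₀ + f₁ + f₂) ^ 2 - e * (g₀ + g₁ + g₂) ^ 2) *
        (eisNorm (f₀ - f₂) (f₁ - f₂) - e * eisNorm (g₀ - g₂) (g₁ - g₂)) ^ 2 := by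
  -- The columns of `P` are two invariant vectors followed by two bases of sum-zero vectors.
  let P : Matrix (Fin 6) (Fin 6) ℤ :=
    !![1, 0, 1, 0, 0, 0;
       1, 0, -1, 1, 0, 0;
       1, 0, 0, -1, 0, 0;
       0, 1, 0, 0, 1, 0;
       0, 1, 0, 0, -1, 1;
       0, 1, 0, 0, 0, -1]
  let Y₁ : Matrix (Fin 2) (Fin 2) ℤ :=
    !![f₀ + f₁ + f₂, e * (g₀ + g₁ + g₂); g₀ + g₁ + g₂, f₀ + f₁ + f₂]
  let Y₂ : Matrix (Fin 4) (Fin 4) ℤ :=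
    !![f₀ - f₂, f₂ - f₁, e * (g₀ - g₁), e * (g₁ - g₂);
       f₁ - f₂, f₀ - f₁, e * (g₂ - g₁), e * (g₀ - g₂);
       g₀ - g₂, g₂ - g₁, f₀ - f₁, f₁ - f₂;
       g₁ - g₂, g₀ - g₁, f₂ - f₁, f₀ - f₂]
  let Y : Matrix (Fin 6) (Fin 6) ℤ :=
    !![f₀ + f₁ + f₂, e * (g₀ + g₁ + g₂), 0, 0, 0, 0;
       g₀ + g₁ + g₂, f₀ + f₁ + f₂, 0, 0, 0, 0;
       0, 0, f₀ - f₂, f₂ - f₁, e * (g₀ - g₁), e * (g₁ - g₂);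
       0, 0, f₁ - f₂, f₀ - f₁, e * (g₂ - g₁), e * (g₀ - g₂);
       0, 0, g₀ - g₂, g₂ - g₁, f₀ - f₁, f₁ - f₂;
       0, 0, g₁ - g₂, g₀ - g₁, f₂ - f₁, f₀ - f₂]
  have hXP : twistedMatrix e f₀ f₁ f₂ g₀ g₁ g₂ * P = P * Y := by
    ext i j
    fin_cases i <;> fin_cases j <;>
      simp [twistedMatrix, P, Y, Matrix.mul_apply, Fin.sum_univ_succ] <;> ring
  have hP : P.det ≠ 0 := by
    have : P.det = 9 ∨ P.det = -9 := by
      simp [P, Matrix.det_succ_row_zero, Fin.sum_univ_succ, Fin.succAbove]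
    omega
  have hY : Y = (Matrix.fromBlocks Y₁ 0 0 Y₂).submatrix (finSumFinEquiv (m := 2) (n := 4)).symm
      (finSumFinEquiv (m := 2) (n := 4)).symm := by
    ext i j
    fin_cases i <;> fin_cases j <;> rfl
  have hdet : (twistedMatrix e f₀ f₁ f₂ g₀ g₁ g₂).det = Y.det := by
    have h := congrArg Matrix.det hXP
    rw [Matrix.det_mul, Matrix.det_mul, mul_comm] at h
    exact mul_left_cancel₀ hP h
  have h₂ : Y₂.det =
      (eisNorm (f₀ - f₂) (f₁ - f₂) - e * eisNorm (g₀ - g₂) (g₁ - g₂)) ^ 2 := by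
    simp [Y₂, Matrix.det_succ_row_zero, Fin.sum_univ_succ, Fin.succAbove, eisNorm]
    ring
  rw [hdet, hY, Matrix.det_submatrix_equiv_self, Matrix.det_fromBlocks_zero₁₂, h₂,
    Matrix.det_fin_two_of]
  ring

/-- Representatives of the cosets of the centre `{1, a³}`. -/
def cosetReps : Fin 6 → QuaternionGroup 3 := fun i =>
  ![.a 0, .a 2, .a 4, .xa 0, .xa 2, .xa 4] i

/-- The enumeration of the group as the coset representatives followed by their `a³`-multiples. -/
def cosetEquivFun : Fin 6 ⊕ Fin 6 → QuaternionGroup 3 :=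
  Sum.elim cosetReps fun i => .a 3 * cosetReps i

theorem cosetEquivFun_bijective : Function.Bijective cosetEquivFun := by
  decide

open QuaternionGroup in
/-- Listing the group by cosets of the centre gives the block shape `[[A, B], [B, A]]`, whose
determinant splits into the contributions of the two eigenspaces of `a³`. -/
theorem groupDet_eq (x : QuaternionGroup 3 → ℤ) :
    groupDet (QuaternionGroup 3) x =
      (twistedMatrix 1 (x (a 0) + x (a 3)) (x (a 2) + x (a 5)) (x (a 4) + x (a 1))
        (x (xa 0) + x (xa 3)) (x (xa 2) + x (xa 5)) (x (xa 4) + x (xa 1))).det *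
      (twistedMatrix (-1) (x (a 0) - x (a 3)) (x (a 2) - x (a 5)) (x (a 4) - x (a 1))
        (x (xa 0) - x (xa 3)) (x (xa 2) - x (xa 5)) (x (xa 4) - x (xa 1))).det := by
  let e := Equiv.ofBijective _ cosetEquivFun_bijective
  let A : Matrix (Fin 6) (Fin 6) ℤ := .of fun i j => x (cosetReps i * (cosetReps j)⁻¹)
  let B : Matrix (Fin 6) (Fin 6) ℤ := .of fun i j => x (.a 3 * cosetReps i * (cosetReps j)⁻¹)
  have h : (Matrix.of fun g h => x (g * h⁻¹)).submatrix e e = Matrix.fromBlocks A B B A := by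
    ext i j
    have hz : ∀ g : QuaternionGroup 3, .a 3 * g = g * .a 3 := by decide
    have hzz : (.a 3 : QuaternionGroup 3)⁻¹ = .a 3 := by decide
    have hz2 : ∀ g h : QuaternionGroup 3, .a 3 * (g * (h * .a 3)) = g * h := by decide
    rcases i with i | i <;> rcases j with j | j
    · rfl
    · simp [e, cosetEquivFun, A, B, hzz, hz, mul_assoc]
    · simp [e, cosetEquivFun, A, B, mul_assoc]
    · simp [e, cosetEquivFun, A, B, hzz, mul_assoc, hz2]
  rw [groupDet, ← Matrix.det_submatrix_equiv_self e, h, det_fromBlocks_symm]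
  congr 2
  · ext i j
    fin_cases i <;> fin_cases j <;> simp [A, B, cosetReps, twistedMatrix] <;>
      first | rfl | exact add_comm _ _
  · ext i j
    fin_cases i <;> fin_cases j <;> simp [A, B, cosetReps, twistedMatrix] <;> rfl


/-! ### Evaluations of the group ring element -/

/-- The congruences characterizing the tuples `(f(1), f(-1), f(ω̄), f(-ω̄))` for an integer
polynomial `f` modulo `x⁶ - 1`, where `f(ω̄) = u₁ + u₂ω` and `f(-ω̄) = v₁ + v₂ω`. The congruence modulo
`1 - ω` becomes a congruence modulo `3` since `u₁ + u₂ω ≡ u₁ + u₂`. Evaluating at `±ω̄` rather than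
`±ω`, which does not affect norms, sends `x²` to `ω` in both cases. -/
def IsEvalData (p p' u₁ u₂ v₁ v₂ : ℤ) : Prop :=
  2 ∣ p - p' ∧ 2 ∣ u₁ - v₁ ∧ 2 ∣ u₂ - v₂ ∧ 3 ∣ p - u₁ - u₂ ∧ 3 ∣ p' - v₁ - v₂

theorem IsEvalData.exists_coeffs {p p' u₁ u₂ v₁ v₂ : ℤ} (h : IsEvalData p p' u₁ u₂ v₁ v₂) :
    ∃ f : ZMod 6 → ℤ,
      p = (f 0 + f 3) + (f 2 + f 5) + (f 4 + f 1) ∧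
      p' = (f 0 - f 3) + (f 2 - f 5) + (f 4 - f 1) ∧
      u₁ = (f 0 + f 3) - (f 4 + f 1) ∧ u₂ = (f 2 + f 5) - (f 4 + f 1) ∧
      v₁ = (f 0 - f 3) - (f 4 - f 1) ∧ v₂ = (f 2 - f 5) - (f 4 - f 1) := by
  obtain ⟨⟨n, hn⟩, ⟨r, hr⟩, ⟨s, hs⟩, ⟨k, hk⟩, ⟨l, hl⟩⟩ := h
  obtain ⟨d, hd⟩ : ∃ d, k - l = 2 * d := ⟨n - r - s - (k - l), by linarith⟩
  let c : Fin 6 → ℤ := ![v₁ + l + r + d, d, v₂ + l + s + d, r + d, l + d, s + d]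
  refine ⟨fun i : Fin 6 => c i, ?_, ?_, ?_, ?_, ?_, ?_⟩
  · change p = (v₁ + l + r + d + (r + d)) + (v₂ + l + s + d + (s + d)) + (l + d + d); linarith
  · change p' = (v₁ + l + r + d - (r + d)) + (v₂ + l + s + d - (s + d)) + (l + d - d); linarith
  · change u₁ = (v₁ + l + r + d + (r + d)) - (l + d + d); linarith
  · change u₂ = (v₂ + l + s + d + (s + d)) - (l + d + d); linarith
  · change v₁ = (v₁ + l + r + d - (r + d)) - (l + d - d); linarith
  · change v₂ = (v₂ + l + s + d - (s + d)) - (l + d - d); linarith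

/-- The determinants are exactly the values of the product formula on two compatible tuples. -/
theorem mem_dets_iff {M : ℤ} : M ∈ integerGroupDets (QuaternionGroup 3) ↔
    ∃ p p' u₁ u₂ v₁ v₂ q q' w₁ w₂ z₁ z₂ : ℤ,
      IsEvalData p p' u₁ u₂ v₁ v₂ ∧ IsEvalData q q' w₁ w₂ z₁ z₂ ∧
      M = (p ^ 2 - q ^ 2) * (p' ^ 2 + q' ^ 2) * (eisNorm u₁ u₂ - eisNorm w₁ w₂) ^ 2 *
        (eisNorm v₁ v₂ + eisNorm z₁ z₂) ^ 2 := by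
  constructor
  · rintro ⟨x, rfl⟩
    have h := groupDet_eq x
    rw [det_twistedMatrix, det_twistedMatrix, neg_one_mul, neg_one_mul, one_mul,
      one_mul, sub_neg_eq_add, sub_neg_eq_add, mul_mul_mul_comm, ← mul_assoc] at h
    exact ⟨_, _, _, _, _, _, _, _, _, _, _, _, by refine ⟨?_, ?_, ?_, ?_, ?_⟩ <;> omega,
      by refine ⟨?_, ?_, ?_, ?_, ?_⟩ <;> omega, h⟩
  · rintro ⟨p, p', u₁, u₂, v₁, v₂, q, q', w₁, w₂, z₁, z₂, hf, hg, rfl⟩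
    obtain ⟨f, rfl, rfl, rfl, rfl, rfl, rfl⟩ := hf.exists_coeffs
    obtain ⟨g, rfl, rfl, rfl, rfl, rfl, rfl⟩ := hg.exists_coeffs
    refine ⟨fun | .a i => f i | .xa i => g i, ?_⟩
    change groupDet (QuaternionGroup 3) _ = _
    rw [groupDet_eq, det_twistedMatrix, det_twistedMatrix, neg_one_mul, neg_one_mul, one_mul,
      one_mul, sub_neg_eq_add, sub_neg_eq_add, mul_mul_mul_comm, ← mul_assoc]

/-- The group determinant turns convolution into multiplication. -/
theorem groupDet_mul {G R : Type*} [Group G] [Fintype G] [DecidableEq G] [CommRing R]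
    (x y : G → R) :
    groupDet G x * groupDet G y = groupDet G fun g => ∑ h, x (g * h⁻¹) * y h := by
  rw [groupDet, groupDet, groupDet, ← Matrix.det_mul]
  congr 1
  ext g k
  simp only [Matrix.mul_apply, Matrix.of_apply]
  exact Fintype.sum_equiv (Equiv.mulRight k⁻¹) _ _ fun h => by simp [mul_assoc]

theorem mul_mem_integerGroupDets {G : Type*} [Group G] [Fintype G] [DecidableEq G] {M N : ℤ}
    (hM : M ∈ integerGroupDets G) (hN : N ∈ integerGroupDets G) :
    M * N ∈ integerGroupDets G := by
  obtain ⟨x, rfl⟩ := hM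
  obtain ⟨y, rfl⟩ := hN
  exact ⟨_, (groupDet_mul x y).symm⟩

local notation "S₁₂" => integerGroupDets (QuaternionGroup 3)

/-! ### Attained values -/

theorem mem_dets_of_eval {M p p' u₁ u₂ v₁ v₂ q q' w₁ w₂ z₁ z₂ : ℤ}
    (hf : IsEvalData p p' u₁ u₂ v₁ v₂) (hg : IsEvalData q q' w₁ w₂ z₁ z₂)
    (hM : (p ^ 2 - q ^ 2) * (p' ^ 2 + q' ^ 2) * (eisNorm u₁ u₂ - eisNorm w₁ w₂) ^ 2 *
        (eisNorm v₁ v₂ + eisNorm z₁ z₂) ^ 2 = M) : M ∈ S₁₂ :=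
  mem_dets_iff.2 ⟨_, _, _, _, _, _, _, _, _, _, _, _, hf, hg, hM.symm⟩

theorem neg_one_mem : (-1 : ℤ) ∈ S₁₂ :=
  mem_dets_of_eval (p := 0) (p' := 0) (u₁ := 0) (u₂ := 0) (v₁ := 0) (v₂ := 0)
    (q := 1) (q' := 1) (w₁ := 1) (w₂ := 0) (z₁ := 1) (z₂ := 0)
    (by norm_num [IsEvalData]) (by norm_num [IsEvalData]) (by norm_num [eisNorm])

theorem neg_mem_dets {M : ℤ} (hM : M ∈ S₁₂) : -M ∈ S₁₂ := by
  simpa using mul_mem_integerGroupDets neg_one_mem hM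

theorem mem_dets_of_mod_six_eq_one {m : ℤ} (hm : m % 6 = 1) : m ∈ S₁₂ := by
  obtain ⟨k, rfl⟩ : ∃ k, m = 6 * k + 1 := ⟨m / 6, by omega⟩
  -- Both cases have `A = (3k + 1)² - (3k)² = m` and `B = C² = D² = 1`. For odd `k` the value `p` is
  -- even, so `B = 1` requires `p' = 0`. This goes with `v = 0` and `u = -2`, and
  -- `C = N(-2) - N(1 - ω) = 1`.
  rcases Int.even_or_odd' k with ⟨j, rfl | rfl⟩
  · refine mem_dets_of_eval (p := 6 * j + 1) (p' := 1) (u₁ := 1) (u₂ := 0) (v₁ := 1) (v₂ := 0)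
      (q := 6 * j) (q' := 0) (w₁ := 0) (w₂ := 0) (z₁ := 0) (z₂ := 0)
      ⟨?_, ?_, ?_, ?_, ?_⟩ ⟨?_, ?_, ?_, ?_, ?_⟩ ?_ <;> try omega
    simp only [eisNorm]; ring
  · refine mem_dets_of_eval (p := 6 * j + 4) (p' := 0) (u₁ := -2) (u₂ := 0) (v₁ := 0) (v₂ := 0)
      (q := 6 * j + 3) (q' := -1) (w₁ := 1) (w₂ := -1) (z₁ := 1) (z₂ := 1)
      ⟨?_, ?_, ?_, ?_, ?_⟩ ⟨?_, ?_, ?_, ?_, ?_⟩ ?_ <;> try omega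
    simp only [eisNorm]; ring

theorem isCoprime_six_iff {m : ℤ} : IsCoprime m 6 ↔ ¬ 2 ∣ m ∧ ¬ 3 ∣ m := by
  rw [show (6 : ℤ) = 2 * 3 by norm_num, IsCoprime.mul_right_iff, isCoprime_comm,
    isCoprime_comm (y := (3 : ℤ)), Int.prime_two.coprime_iff_not_dvd,
    Int.prime_three.coprime_iff_not_dvd]

theorem mem_dets_of_isCoprime_six {m : ℤ} (hm : IsCoprime m 6) : m ∈ S₁₂ := by
  rw [isCoprime_six_iff] at hm
  have h : m % 6 = 1 ∨ -m % 6 = 1 := by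
    have h6 : m % 6 = 0 ∨ m % 6 = 1 ∨ m % 6 = 2 ∨ m % 6 = 3 ∨ m % 6 = 4 ∨ m % 6 = 5 := by omega
    omega
  rcases h with h | h
  · exact mem_dets_of_mod_six_eq_one h
  · simpa using neg_mem_dets (mem_dets_of_mod_six_eq_one h)

theorem two_pow_mem {a : ℕ} (ha : a = 0 ∨ a = 4 ∨ 6 ≤ a) : (2 : ℤ) ^ a ∈ S₁₂ := by
  have h4 : (2 : ℤ) ^ 4 ∈ S₁₂ :=
    mem_dets_of_eval (p := -2) (p' := -2) (u₁ := 0) (u₂ := 1) (v₁ := 0) (v₂ := 1)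
      (q := 0) (q' := 0) (w₁ := 0) (w₂ := 0) (z₁ := 0) (z₂ := 0)
      (by norm_num [IsEvalData]) (by norm_num [IsEvalData]) (by norm_num [eisNorm])
  induction a using Nat.strong_induction_on with
  | _ a ih =>
  by_cases h10 : a = 8 ∨ 10 ≤ a
  · have := mul_mem_integerGroupDets (ih (a - 4) (by omega) (by omega)) h4
    rwa [← pow_add, Nat.sub_add_cancel (by omega)] at this
  have : a = 0 ∨ a = 4 ∨ a = 6 ∨ a = 7 ∨ a = 9 := by omega
  rcases this with rfl | rfl | rfl | rfl | rfl
  · exact mem_dets_of_isCoprime_six isCoprime_one_left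
  · exact h4
  · exact mem_dets_of_eval (p := -1) (p' := -1) (u₁ := -1) (u₂ := 0) (v₁ := -1) (v₂ := 0)
      (q := 0) (q' := 0) (w₁ := -1) (w₂ := 1) (z₁ := -1) (z₂ := 1)
      (by norm_num [IsEvalData]) (by norm_num [IsEvalData]) (by norm_num [eisNorm])
  · exact mem_dets_of_eval (p := -6) (p' := -2) (u₁ := -2) (u₂ := -1) (v₁ := 0) (v₂ := 1)
      (q := -2) (q' := 0) (w₁ := -2) (w₂ := 0) (z₁ := 0) (z₂ := 0)
      (by norm_num [IsEvalData]) (by norm_num [IsEvalData]) (by norm_num [eisNorm])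
  · exact mem_dets_of_eval (p := -2) (p' := -2) (u₁ := 0) (u₂ := 1) (v₁ := 0) (v₂ := 1)
      (q := 0) (q' := -2) (w₁ := -2) (w₂ := -1) (z₁ := 0) (z₂ := 1)
      (by norm_num [IsEvalData]) (by norm_num [IsEvalData]) (by norm_num [eisNorm])

theorem three_pow_mem {b : ℕ} (hb : b = 0 ∨ 3 ≤ b) : (3 : ℤ) ^ b ∈ S₁₂ := by
  have h3 : (3 : ℤ) ^ 3 ∈ S₁₂ :=
    mem_dets_of_eval (p := -2) (p' := 0) (u₁ := -2) (u₂ := 0) (v₁ := 0) (v₂ := 0)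
      (q := -1) (q' := -1) (w₁ := -1) (w₂ := 0) (z₁ := -1) (z₂ := 0)
      (by norm_num [IsEvalData]) (by norm_num [IsEvalData]) (by norm_num [eisNorm])
  induction b using Nat.strong_induction_on with
  | _ b ih =>
  by_cases h6 : 6 ≤ b
  · have := mul_mem_integerGroupDets (ih (b - 3) (by omega) (by omega)) h3
    rwa [← pow_add, Nat.sub_add_cancel (by omega)] at this
  have : b = 0 ∨ b = 3 ∨ b = 4 ∨ b = 5 := by omega
  rcases this with rfl | rfl | rfl | rfl
  · exact mem_dets_of_isCoprime_six isCoprime_one_left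
  · exact h3
  · exact mem_dets_of_eval (p := -3) (p' := 1) (u₁ := -2) (u₂ := -1) (v₁ := 0) (v₂ := 1)
      (q := 0) (q' := 0) (w₁ := 0) (w₂ := 0) (z₁ := 0) (z₂ := 0)
      (by norm_num [IsEvalData]) (by norm_num [IsEvalData]) (by norm_num [eisNorm])
  · exact mem_dets_of_eval (p := -2) (p' := 0) (u₁ := -2) (u₂ := 0) (v₁ := 0) (v₂ := 0)
      (q := -1) (q' := 1) (w₁ := -4) (w₂ := -3) (z₁ := 0) (z₂ := 1)
      (by norm_num [IsEvalData]) (by norm_num [IsEvalData]) (by norm_num [eisNorm])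

theorem thirtyTwo_mul_three_pow_mem {b : ℕ} (hb : b = 4 ∨ 6 ≤ b) :
    (2 : ℤ) ^ 5 * 3 ^ b ∈ S₁₂ := by
  have h4 : (2 : ℤ) ^ 5 * 3 ^ 4 ∈ S₁₂ :=
    mem_dets_of_eval (p := 5) (p' := 3) (u₁ := 1) (u₂ := 1) (v₁ := 1) (v₂ := -1)
      (q := 3) (q' := 3) (w₁ := 0) (w₂ := 0) (z₁ := 0) (z₂ := 0)
      (by norm_num [IsEvalData]) (by norm_num [IsEvalData]) (by norm_num [eisNorm])
  have h : b = 4 ∨ b = 6 ∨ 7 ≤ b := by omega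
  rcases h with rfl | rfl | h
  · exact h4
  · exact mem_dets_of_eval (p := 5) (p' := 3) (u₁ := -1) (u₂ := 0) (v₁ := 3) (v₂ := 0)
      (q := 3) (q' := 3) (w₁ := 0) (w₂ := 0) (z₁ := 0) (z₂ := 0)
      (by norm_num [IsEvalData]) (by norm_num [IsEvalData]) (by norm_num [eisNorm])
  · have := mul_mem_integerGroupDets h4 (three_pow_mem (b := b - 4) (by omega))
    rwa [mul_assoc, ← pow_add, Nat.add_sub_cancel' (by omega)] at this

theorem thirtyTwo_mul_prime_mem {p : ℕ} (hp : p.Prime) (h5 : p % 12 = 5) :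
    (2 : ℤ) ^ 5 * p ∈ S₁₂ := by
  have := Fact.mk hp
  obtain ⟨r, s, hrs⟩ := Nat.Prime.sq_add_sq (p := p) (by omega)
  -- As `p ≡ 2` modulo `3`, neither `r` nor `s` is divisible by `3`, so exactly one of `r ± s` is.
  -- Up to signs these two numbers serve as `P` and `Q`.
  obtain ⟨P, Q, hPQ, hP2, hQ2, hP, hQ⟩ : ∃ P Q : ℤ, P ^ 2 + Q ^ 2 = 2 * p ∧ P % 2 = 1 ∧
      Q % 2 = 1 ∧ P % 3 = 1 ∧ Q % 3 = 0 := by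
    have hz : (r : ℤ) ^ 2 + s ^ 2 = p := by exact_mod_cast hrs
    have h₂ : ((r : ℤ) + s) % 2 = 1 := by
      have := congrArg (· % 2) hz
      rcases Int.emod_two_eq_zero_or_one r with h | h <;>
        rcases Int.emod_two_eq_zero_or_one s with h' | h' <;>
        simp [pow_two, Int.add_emod, Int.mul_emod, h, h'] at this ⊢ <;> omega
    have h₃ : (r : ℤ) % 3 ≠ 0 ∧ (s : ℤ) % 3 ≠ 0 := by
      have := congrArg (· % 3) hz
      have hr : (r : ℤ) % 3 = 0 ∨ (r : ℤ) % 3 = 1 ∨ (r : ℤ) % 3 = 2 := by omega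
      have hs : (s : ℤ) % 3 = 0 ∨ (s : ℤ) % 3 = 1 ∨ (s : ℤ) % 3 = 2 := by omega
      rcases hr with h | h | h <;> rcases hs with h' | h' | h' <;>
        simp [pow_two, Int.add_emod, Int.mul_emod, h, h'] at this ⊢ <;> omega
    have h : ((r : ℤ) + s) % 3 = 1 ∧ ((r : ℤ) - s) % 3 = 0 ∨
        (-(r : ℤ) - s) % 3 = 1 ∧ ((r : ℤ) - s) % 3 = 0 ∨
        ((r : ℤ) - s) % 3 = 1 ∧ ((r : ℤ) + s) % 3 = 0 ∨
        (-(r : ℤ) + s) % 3 = 1 ∧ ((r : ℤ) + s) % 3 = 0 := by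
      have hr : (r : ℤ) % 3 = 1 ∨ (r : ℤ) % 3 = 2 := by omega
      have hs : (s : ℤ) % 3 = 1 ∨ (s : ℤ) % 3 = 2 := by omega
      rcases hr with hr | hr <;> rcases hs with hs | hs <;> omega
    rcases h with ⟨h, h'⟩ | ⟨h, h'⟩ | ⟨h, h'⟩ | ⟨h, h'⟩ <;>
      refine ⟨_, _, ?_, ?_, ?_, h, h'⟩ <;> first | omega | linear_combination 2 * hz
  refine mem_dets_of_eval (p := 5) (p' := P) (u₁ := -1) (u₂ := 0) (v₁ := 1) (v₂ := 0)
      (q := 3) (q' := Q) (w₁ := 0) (w₂ := 0) (z₁ := 0) (z₂ := 0)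
      ⟨?_, ?_, ?_, ?_, ?_⟩ ⟨?_, ?_, ?_, ?_, ?_⟩ ?_ <;> try omega
  rw [hPQ]
  norm_num [eisNorm]
  ring


/-! ### Sums of two Eisenstein norms -/

theorem eisNorm_nonneg (x y : ℤ) : 0 ≤ eisNorm x y := by
  unfold eisNorm
  nlinarith [sq_nonneg (x - y), sq_nonneg x, sq_nonneg y]

/-- A positive definite Hermitian matrix `[[a, β], [β̄, c]]` of determinant `1` over the Eisenstein
integers, with `β = x + yω`, is the Gram matrix of two vectors `(v, z)` and `(w, t)`. The proof is by
descent: reduce `β` modulo `a`, which makes the new `c` smaller than `a`, and exchange the two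
vectors. -/
theorem exists_hermitian_gram (a : ℕ) : ∀ c x y : ℤ, a * c = eisNorm x y + 1 →
    ∃ v₁ v₂ z₁ z₂ w₁ w₂ t₁ t₂ : ℤ, a = eisNorm v₁ v₂ + eisNorm z₁ z₂ ∧
      c = eisNorm w₁ w₂ + eisNorm t₁ t₂ ∧
      x = v₁ * w₁ - v₁ * w₂ + v₂ * w₂ + (z₁ * t₁ - z₁ * t₂ + z₂ * t₂) ∧
      y = v₂ * w₁ - v₁ * w₂ + (z₂ * t₁ - z₁ * t₂) := by
  induction a using Nat.strong_induction_on with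
  | _ a ih =>
  intro c x y h
  have hpos := eisNorm_nonneg x y
  rcases Nat.eq_zero_or_pos a with rfl | ha
  · simp at h; omega
  rcases Nat.eq_or_lt_of_le ha with rfl | ha
  · refine ⟨1, 0, 0, 0, x - y, -y, 1, 0, ?_, ?_, ?_, ?_⟩ <;> simp [eisNorm] at h ⊢
    linear_combination h
  -- The half-open interval matters for `a = 2`: the residues `1` and `-1` together would give the
  -- norm `3`, and `c` would not drop below `a`.
  obtain ⟨s, x', hx, hx₁, hx₂⟩ : ∃ s x', x = x' + a * s ∧ -(a : ℤ) ≤ 2 * x' ∧ 2 * x' < a :=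
    ⟨_, _, (Int.bmod_add_bdiv x a).symm, by have := Int.le_bmod (x := x) ha.le; omega,
      by have := Int.bmod_lt (x := x) ha.le; omega⟩
  obtain ⟨s', y', hy, hy₁, hy₂⟩ : ∃ s x', y = x' + a * s ∧ -(a : ℤ) ≤ 2 * x' ∧ 2 * x' < a :=
    ⟨_, _, (Int.bmod_add_bdiv y a).symm, by have := Int.le_bmod (x := y) ha.le; omega,
      by have := Int.bmod_lt (x := y) ha.le; omega⟩
  obtain ⟨c', hc'⟩ : ∃ c' : ℤ, c' = c - (2 * s - s') * x' - (2 * s' - s) * y' -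
    a * eisNorm s s' := ⟨_, rfl⟩
  have h' : c' * a = eisNorm (x' - y') (-y') + 1 := by
    subst hx hy
    simp only [eisNorm] at h hc' ⊢
    linear_combination a * hc' + h
  have hpos' := eisNorm_nonneg (x' - y') (-y')
  have hc'0 : 0 < c' := pos_of_mul_pos_left (h' ▸ by omega) (Int.natCast_nonneg a)
  have hlt : c' < a := by
    suffices h : eisNorm (x' - y') (-y') + 1 < a * a from
      lt_of_mul_lt_mul_right (h' ▸ h) (Int.natCast_nonneg a)
    rcases Nat.eq_or_lt_of_le ha with rfl | ha
    · have hx0 : x' = 0 ∨ x' = -1 := by push_cast at *; omega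
      have hy0 : y' = 0 ∨ y' = -1 := by push_cast at *; omega
      rcases hx0 with rfl | rfl <;> rcases hy0 with rfl | rfl <;> norm_num [eisNorm]
    · have ha3 : (3 : ℤ) ≤ a := by exact_mod_cast ha
      have e₁ : (2 * x') ^ 2 ≤ (a : ℤ) ^ 2 := sq_le_sq' hx₁ hx₂.le
      have e₂ : (2 * y') ^ 2 ≤ (a : ℤ) ^ 2 := sq_le_sq' hy₁ hy₂.le
      unfold eisNorm
      nlinarith [sq_nonneg (x' + y')]
  lift c' to ℕ using hc'0.le
  obtain ⟨w₁, w₂, t₁, t₂, v₁, v₂, z₁, z₂, hC, hA, h₁, h₂⟩ :=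
    ih c' (by exact_mod_cast hlt) a _ _ h'
  refine ⟨v₁, v₂, z₁, z₂, w₁ + ((s - s') * v₁ + s' * v₂), w₂ + (s * v₂ - s' * v₁),
    t₁ + ((s - s') * z₁ + s' * z₂), t₂ + (s * z₂ - s' * z₁), hA, ?_, ?_, ?_⟩
  all_goals simp only [eisNorm] at hA hC hc' ⊢
  · linear_combination hC - hc' + (2 * s - s') * (h₁ - h₂) - (2 * s' - s) * h₂ +
      (s ^ 2 - s * s' + s' ^ 2) * hA
  · linear_combination hx + h₁ - h₂ + s * hA
  · linear_combination hy - h₂ + s' * hA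

open Polynomial in
/-- Since `r² + 3s² = N((r + s) + 2sω)`, solving `r² + 3s² ≡ -1` modulo `p` provides a Hermitian matrix
of determinant `1` with corner entry `p`. -/
theorem Nat.Prime.eq_eisNorm_add_eisNorm {p : ℕ} (hp : p.Prime) (h2 : p ≠ 2) (h3 : p ≠ 3) :
    ∃ v₁ v₂ z₁ z₂ : ℤ, (p : ℤ) = eisNorm v₁ v₂ + eisNorm z₁ z₂ := by
  have := Fact.mk hp
  have h3' : (3 : ZMod p) ≠ 0 := fun h => h3 <| by
    have : ((3 : ℕ) : ZMod p) = 0 := by exact_mod_cast h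
    exact (Nat.prime_dvd_prime_iff_eq hp Nat.prime_three).1
      ((ZMod.natCast_eq_zero_iff 3 p).1 this)
  obtain ⟨r, s, hrs⟩ := FiniteField.exists_root_sum_quadratic (R := ZMod p)
    (f := X ^ 2 + C 1) (g := C 3 * X ^ 2) (degree_X_pow_add_C two_pos 1)
    (degree_C_mul_X_pow 2 h3') (by rw [ZMod.card]; exact hp.eq_two_or_odd.resolve_left h2)
  obtain ⟨r, rfl⟩ := ZMod.intCast_surjective r
  obtain ⟨s, rfl⟩ := ZMod.intCast_surjective s
  have hdvd : (p : ℤ) ∣ eisNorm (r + s) (2 * s) + 1 := by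
    rw [← ZMod.intCast_zmod_eq_zero_iff_dvd]
    simp only [eval_add, eval_pow, eval_X, eval_C, eval_mul] at hrs
    simp only [eisNorm]
    push_cast
    linear_combination hrs
  obtain ⟨c, hc⟩ := hdvd
  obtain ⟨v₁, v₂, z₁, z₂, -, -, -, -, h, -⟩ := exists_hermitian_gram p c _ _ hc.symm
  exact ⟨v₁, v₂, z₁, z₂, h⟩

theorem eisNorm_neg (x y : ℤ) : eisNorm (-x) (-y) = eisNorm x y := by
  unfold eisNorm; ring

/-- An Eisenstein integer prime to `1 - ω` is, up to sign, congruent to `1` modulo `1 - ω`. -/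
theorem exists_sign_eisNorm {x y : ℤ} (h : ¬ 3 ∣ eisNorm x y) :
    ∃ x' y', eisNorm x' y' = eisNorm x y ∧ x' % 2 = x % 2 ∧ y' % 2 = y % 2 ∧
      (x' + y') % 3 = 1 := by
  have h3 : ¬ 3 ∣ x + y := fun h3 => h <| by
    rw [show eisNorm x y = (x + y) * (x + y) - 3 * (x * y) by unfold eisNorm; ring]
    exact dvd_sub (h3.mul_right _) (dvd_mul_right _ _)
  have : (x + y) % 3 = 1 ∨ (-x + -y) % 3 = 1 := by omega
  rcases this with h | h
  · exact ⟨x, y, rfl, rfl, rfl, h⟩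
  · exact ⟨-x, -y, eisNorm_neg x y, by omega, by omega, h⟩

theorem eisNorm_emod_two (x y : ℤ) :
    eisNorm x y % 2 = 0 ∧ x % 2 = 0 ∧ y % 2 = 0 ∨
      eisNorm x y % 2 = 1 ∧ (x % 2 = 1 ∨ y % 2 = 1) := by
  rcases Int.emod_two_eq_zero_or_one x with h | h <;>
    rcases Int.emod_two_eq_zero_or_one y with h' | h' <;>
    simp [eisNorm, pow_two, Int.add_emod, Int.sub_emod, Int.mul_emod, h, h']

/-- An Eisenstein integer of odd norm has an associate congruent to `1` modulo `2`. -/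
theorem exists_associate_eisNorm {x y : ℤ} (h2 : eisNorm x y % 2 = 1) :
    ∃ x' y', eisNorm x' y' = eisNorm x y ∧ x' % 2 = 1 ∧ y' % 2 = 0 := by
  have hxy : y % 2 = 0 ∧ x % 2 = 1 ∨ x % 2 = 0 ∧ y % 2 = 1 ∨ x % 2 = 1 ∧ y % 2 = 1 := by
    have := eisNorm_emod_two x y
    omega
  rcases hxy with ⟨h, h'⟩ | ⟨h, h'⟩ | ⟨h, h'⟩
  · exact ⟨x, y, rfl, h', h⟩
  · exact ⟨y - x, -x, by unfold eisNorm; ring, by omega, by omega⟩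
  · exact ⟨-y, x - y, by unfold eisNorm; ring, by omega, by omega⟩

theorem eisNorm_emod_three (x y : ℤ) : eisNorm x y % 3 = 0 ∨ eisNorm x y % 3 = 1 := by
  have hx : x % 3 = 0 ∨ x % 3 = 1 ∨ x % 3 = 2 := by omega
  have hy : y % 3 = 0 ∨ y % 3 = 1 ∨ y % 3 = 2 := by omega
  rcases hx with h | h | h <;> rcases hy with h' | h' | h' <;>
    simp [eisNorm, pow_two, Int.add_emod, Int.sub_emod, Int.mul_emod, h, h']

theorem thirtyTwo_mul_prime_sq_mem {p : ℕ} (hp : p.Prime) (h5 : p % 6 = 5) :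
    (2 : ℤ) ^ 5 * (p : ℤ) ^ 2 ∈ S₁₂ := by
  -- The values are `A = 5² - 3²`, `B = 2`, `C = 1` and `D = p`.
  obtain ⟨v₁, v₂, z₁, z₂, h, hodd⟩ : ∃ v₁ v₂ z₁ z₂ : ℤ,
      (p : ℤ) = eisNorm v₁ v₂ + eisNorm z₁ z₂ ∧ eisNorm v₁ v₂ % 2 = 1 := by
    obtain ⟨v₁, v₂, z₁, z₂, h⟩ := hp.eq_eisNorm_add_eisNorm (by omega) (by omega)
    rcases Int.emod_two_eq_zero_or_one (eisNorm v₁ v₂) with h' | h'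
    · exact ⟨z₁, z₂, v₁, v₂, by rw [h, add_comm], by omega⟩
    · exact ⟨v₁, v₂, z₁, z₂, h, h'⟩
  have hv3 := eisNorm_emod_three v₁ v₂
  have hz3 := eisNorm_emod_three z₁ z₂
  obtain ⟨v₁', v₂', hv, hv₁, hv₂⟩ := exists_associate_eisNorm hodd
  obtain ⟨a₁, a₂, ha, ha₁, ha₂, ha₃⟩ := exists_sign_eisNorm (x := v₁') (y := v₂') (by omega)
  obtain ⟨b₁, b₂, hb, hb₁, hb₂, hb₃⟩ := exists_sign_eisNorm (x := z₁) (y := z₂) (by omega)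
  have hz2 := eisNorm_emod_two z₁ z₂
  refine mem_dets_of_eval (p := 5) (p' := 1) (u₁ := -1) (u₂ := 0) (v₁ := a₁) (v₂ := a₂)
      (q := 3) (q' := 1) (w₁ := 0) (w₂ := 0) (z₁ := b₁) (z₂ := b₂)
      ⟨?_, ?_, ?_, ?_, ?_⟩ ⟨?_, ?_, ?_, ?_, ?_⟩ ?_ <;> try omega
  rw [ha, hb, hv, ← h]
  norm_num [eisNorm]


/-! ### Restrictions on the values -/

theorem Nat.exists_prime_dvd_of_mod_three_eq_two {n : ℕ} (h : n % 3 = 2) :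
    ∃ p, p.Prime ∧ p ∣ n ∧ p % 3 = 2 := by
  induction n using Nat.strong_induction_on with
  | _ n ih =>
  have hp : n.minFac.Prime := Nat.minFac_prime (by omega)
  obtain ⟨k, hk⟩ := n.minFac_dvd
  have hmod : n.minFac % 3 * (k % 3) % 3 = 2 := by rw [← Nat.mul_mod, ← hk, h]
  have hlt : n.minFac % 3 < 3 := Nat.mod_lt _ (by norm_num)
  interval_cases hm : n.minFac % 3
  · omega
  · have hkn : k < n := by
      have := hp.two_le
      have : k ≠ 0 := by rintro rfl; omega
      rw [hk]
      nlinarith [Nat.pos_of_ne_zero this]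
    obtain ⟨p, hp, hpk, hp3⟩ := ih k hkn (by omega)
    exact ⟨p, hp, hpk.trans ⟨n.minFac, by rw [mul_comm]; exact hk⟩, hp3⟩
  · exact ⟨_, hp, n.minFac_dvd, hm⟩

theorem dvd_of_dvd_sq_add_sq {p : ℕ} (hp : p.Prime) (h : p % 4 = 3) {x y : ℤ}
    (hd : (p : ℤ) ∣ x ^ 2 + y ^ 2) : (p : ℤ) ∣ x ∧ (p : ℤ) ∣ y := by
  have := Fact.mk hp
  have hp' := Nat.prime_iff_prime_int.1 hp
  have hy : (p : ℤ) ∣ y := by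
    rw [← ZMod.intCast_zmod_eq_zero_iff_dvd] at hd ⊢
    push_cast at hd
    by_contra hy
    exact ZMod.mod_four_ne_three_of_sq_eq_neg_sq' hy (eq_neg_of_add_eq_zero_left hd) h
  exact ⟨hp'.dvd_of_dvd_pow ((dvd_add_left (hy.pow two_ne_zero)).1 hd), hy⟩

theorem sq_dvd_sq_add_sq {p : ℕ} (hp : p.Prime) (h : p % 4 = 3) {x y : ℤ}
    (hd : (p : ℤ) ∣ x ^ 2 + y ^ 2) : (p : ℤ) ^ 2 ∣ x ^ 2 + y ^ 2 := by
  obtain ⟨hx, hy⟩ := dvd_of_dvd_sq_add_sq hp h hd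
  exact dvd_add (pow_dvd_pow_of_dvd hx 2) (pow_dvd_pow_of_dvd hy 2)

/-- The power of `2` in the contribution `A * B` of the one-dimensional representations. It is never
`2⁵` unless `B` is `2` or `8` times an odd number. -/
theorem linear_parity {p p' q q' : ℤ} (hp : 2 ∣ p - p') (hq : 2 ∣ q - q') :
    ((p ^ 2 - q ^ 2) % 2 = 1 ∧ (p' ^ 2 + q' ^ 2) % 2 = 1) ∨
    2 ^ 4 ∣ (p ^ 2 - q ^ 2) * (p' ^ 2 + q' ^ 2) ∧
      (2 ^ 5 ∣ (p ^ 2 - q ^ 2) * (p' ^ 2 + q' ^ 2) →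
        2 ^ 6 ∣ (p ^ 2 - q ^ 2) * (p' ^ 2 + q' ^ 2) ∨
        ∃ e B : ℤ, (e = 2 ∨ e = 8) ∧ p' ^ 2 + q' ^ 2 = e * B ∧ B % 2 = 1) := by
  rcases Int.emod_two_eq_zero_or_one p with hp2 | hp2 <;>
    rcases Int.emod_two_eq_zero_or_one q with hq2 | hq2
  · right
    obtain ⟨P, rfl⟩ : 2 ∣ p := by omega
    obtain ⟨Q, rfl⟩ : 2 ∣ q := by omega
    obtain ⟨R, rfl⟩ : 2 ∣ p' := by omega
    obtain ⟨S, rfl⟩ : 2 ∣ q' := by omega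
    have e : ((2 * P) ^ 2 - (2 * Q) ^ 2) * ((2 * R) ^ 2 + (2 * S) ^ 2) =
      2 ^ 4 * ((P ^ 2 - Q ^ 2) * (R ^ 2 + S ^ 2)) := by ring
    rw [e]
    refine ⟨dvd_mul_right _ _, fun h => ?_⟩
    have h' : 2 ∣ (P ^ 2 - Q ^ 2) * (R ^ 2 + S ^ 2) := by omega
    rcases Int.prime_two.dvd_or_dvd h' with hA | hB
    -- An even difference of two squares is divisible by `4`.
    · left
      have hPQ : 2 ∣ (P - Q) * (P + Q) := by
        rwa [show (P - Q) * (P + Q) = P ^ 2 - Q ^ 2 by ring]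
      have : 2 ∣ P - Q ∧ 2 ∣ P + Q := by
        rcases Int.prime_two.dvd_or_dvd hPQ with h | h <;> constructor <;> omega
      have h4 : (2 * 2 : ℤ) ∣ (P - Q) * (P + Q) := mul_dvd_mul this.1 this.2
      rw [show (P - Q) * (P + Q) = P ^ 2 - Q ^ 2 by ring] at h4
      rw [show (2 : ℤ) ^ 6 = 2 ^ 4 * (2 * 2) by norm_num]
      exact mul_dvd_mul_left _ (h4.mul_right _)
    · obtain ⟨B, hB⟩ := hB
      rcases Int.emod_two_eq_zero_or_one B with h0 | h1
      · left
        have h4 : (4 : ℤ) ∣ R ^ 2 + S ^ 2 := by omega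
        rw [show (2 : ℤ) ^ 6 = 2 ^ 4 * 4 by norm_num]
        exact mul_dvd_mul_left _ (h4.mul_left _)
      · exact .inr ⟨8, B, .inr rfl, by linear_combination 4 * hB, h1⟩
  · left
    have hp' : p' % 2 = 0 := by omega
    have hq' : q' % 2 = 1 := by omega
    simp [pow_two, Int.add_emod, Int.sub_emod, Int.mul_emod, *]
  · left
    have hp' : p' % 2 = 1 := by omega
    have hq' : q' % 2 = 0 := by omega
    simp [pow_two, Int.add_emod, Int.sub_emod, Int.mul_emod, *]
  · right
    have hA : (8 : ℤ) ∣ p ^ 2 - q ^ 2 := by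
      simpa using dvd_sub (Int.eight_dvd_sq_sub_one_of_odd (Int.odd_iff.2 hp2))
        (Int.eight_dvd_sq_sub_one_of_odd (Int.odd_iff.2 hq2))
    have h₁ := Int.sq_mod_four_eq_one_of_odd (x := p') (Int.odd_iff.2 (by omega))
    have h₂ := Int.sq_mod_four_eq_one_of_odd (x := q') (Int.odd_iff.2 (by omega))
    have hB : (2 : ℤ) ∣ p' ^ 2 + q' ^ 2 := by omega
    refine ⟨by simpa using mul_dvd_mul hA hB, fun _ => .inr ⟨2, (p' ^ 2 + q' ^ 2) / 2, .inl rfl,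
      by omega, by omega⟩⟩

theorem pow_two_dvd_of_odd {n : ℕ} {A c : ℤ} (hc : c % 2 = 1) (h : 2 ^ n ∣ A * c) : 2 ^ n ∣ A :=
  (IsCoprime.pow_left ((Int.prime_two.coprime_iff_not_dvd).2 (by omega))).dvd_of_dvd_mul_right h

/-- The power of `2` in a determinant; `P` stands for the shape of `B` when `2⁵` exactly divides
`A * B`. An even `C` or `D` makes both even, and then the power `2⁵` cannot be exact. -/
theorem two_adic {A B C D : ℤ} {P : Prop} (hCD : C % 2 = D % 2)
    (hAB : (A % 2 = 1 ∧ B % 2 = 1) ∨ 2 ^ 4 ∣ A * B ∧ (2 ^ 5 ∣ A * B → 2 ^ 6 ∣ A * B ∨ P)) :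
    (2 ∣ A * B * C ^ 2 * D ^ 2 → 2 ^ 4 ∣ A * B * C ^ 2 * D ^ 2) ∧
    (2 ^ 5 ∣ A * B * C ^ 2 * D ^ 2 → 2 ^ 6 ∣ A * B * C ^ 2 * D ^ 2 ∨ (D % 2 = 1 ∧ P)) := by
  rcases Int.emod_two_eq_zero_or_one D with hD | hD
  · obtain ⟨c, rfl⟩ : 2 ∣ C := by omega
    obtain ⟨d, rfl⟩ : 2 ∣ D := by omega
    have e : A * B * (2 * c) ^ 2 * (2 * d) ^ 2 = 2 ^ 4 * (A * B * (c * d) ^ 2) := by ring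
    rw [e]
    refine ⟨fun _ => dvd_mul_right _ _, fun h => .inl ?_⟩
    suffices h4 : 2 ^ 2 ∣ A * B * (c * d) ^ 2 by
      rw [show (2 : ℤ) ^ 6 = 2 ^ 4 * 2 ^ 2 by norm_num]
      exact mul_dvd_mul_left _ h4
    rcases hAB with ⟨hA, hB⟩ | ⟨hAB, -⟩
    · have h2 : 2 ∣ A * B * (c * d) ^ 2 := by omega
      have hAB : ¬ 2 ∣ A * B := fun h => by
        rcases Int.prime_two.dvd_or_dvd h with h | h <;> omega
      have := Int.prime_two.dvd_of_dvd_pow ((Int.prime_two.dvd_or_dvd h2).resolve_left hAB)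
      exact (pow_dvd_pow_of_dvd this 2).mul_left _
    · exact ((pow_dvd_pow 2 (by norm_num)).trans hAB).mul_right _
  · have hodd : (C ^ 2 * D ^ 2) % 2 = 1 := by
      simp [pow_two, Int.mul_emod, hD, hCD]
    rw [mul_assoc (A * B)]
    refine ⟨fun h => ?_, fun h => ?_⟩
    · have h := pow_two_dvd_of_odd (n := 1) hodd (by simpa using h)
      rcases hAB with ⟨hA, hB⟩ | ⟨hAB, -⟩
      · rcases Int.prime_two.dvd_or_dvd (by simpa using h) with h | h <;> omega
      · exact hAB.mul_right _
    · have h := pow_two_dvd_of_odd hodd h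
      rcases hAB with ⟨hA, hB⟩ | ⟨-, hAB⟩
      · rcases Int.prime_two.dvd_or_dvd ((dvd_pow_self 2 (by norm_num)).trans h) with h | h <;>
          omega
      · exact (hAB h).imp (·.mul_right _) (⟨hD, ·⟩)

/-- The power of `3` in a determinant, with `B = x² + y²`. -/
theorem three_adic {A C D x y : ℤ} (hAC : 3 ∣ A - C) (hBD : 3 ∣ x ^ 2 + y ^ 2 - D) :
    (3 ∣ A * (x ^ 2 + y ^ 2) * C ^ 2 * D ^ 2 → 3 ^ 3 ∣ A * (x ^ 2 + y ^ 2) * C ^ 2 * D ^ 2) ∧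
    (3 ∣ D → 3 ^ 4 ∣ A * (x ^ 2 + y ^ 2) * C ^ 2 * D ^ 2 ∧
      (3 ^ 5 ∣ A * (x ^ 2 + y ^ 2) * C ^ 2 * D ^ 2 →
        3 ^ 6 ∣ A * (x ^ 2 + y ^ 2) * C ^ 2 * D ^ 2)) := by
  have hsq : ∀ {x y : ℤ}, 3 ∣ x ^ 2 + y ^ 2 → 3 ∣ x ∧ 3 ∣ y := fun h =>
    dvd_of_dvd_sq_add_sq (p := 3) Nat.prime_three rfl h
  have hD4 : 3 ∣ D → 3 ^ 4 ∣ A * (x ^ 2 + y ^ 2) * C ^ 2 * D ^ 2 ∧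
      (3 ^ 5 ∣ A * (x ^ 2 + y ^ 2) * C ^ 2 * D ^ 2 →
        3 ^ 6 ∣ A * (x ^ 2 + y ^ 2) * C ^ 2 * D ^ 2) := fun hD => by
    obtain ⟨⟨x, rfl⟩, ⟨y, rfl⟩⟩ := hsq (x := x) (y := y) (by omega)
    obtain ⟨d, rfl⟩ := hD
    have e : A * ((3 * x) ^ 2 + (3 * y) ^ 2) * C ^ 2 * (3 * d) ^ 2 =
      3 ^ 4 * (A * C ^ 2 * ((x ^ 2 + y ^ 2) * d ^ 2)) := by ring
    rw [e]
    refine ⟨dvd_mul_right _ _, fun h => ?_⟩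
    suffices h9 : 3 ^ 2 ∣ A * C ^ 2 * ((x ^ 2 + y ^ 2) * d ^ 2) by
      rw [show (3 : ℤ) ^ 6 = 3 ^ 4 * 3 ^ 2 by norm_num]
      exact mul_dvd_mul_left _ h9
    have h3 : 3 ∣ A * C ^ 2 * ((x ^ 2 + y ^ 2) * d ^ 2) := by omega
    have hp := Int.prime_three
    rcases hp.dvd_or_dvd h3 with h | h
    · have hA : 3 ∣ A := by
        rcases hp.dvd_or_dvd h with h | h
        · exact h
        · have := hp.dvd_of_dvd_pow h; omega
      have hC : 3 ∣ C := by omega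
      exact ((pow_dvd_pow_of_dvd hC 2).mul_left _).mul_right _
    · refine Dvd.dvd.mul_left ?_ _
      rcases hp.dvd_or_dvd h with h | h
      · obtain ⟨hx, hy⟩ := hsq h
        exact (dvd_add (pow_dvd_pow_of_dvd hx 2) (pow_dvd_pow_of_dvd hy 2)).mul_right _
      · exact (pow_dvd_pow_of_dvd (hp.dvd_of_dvd_pow h) 2).mul_left _
  refine ⟨fun h => ?_, hD4⟩
  by_cases hD : 3 ∣ D
  · exact (pow_dvd_pow 3 (by norm_num)).trans (hD4 hD).1
  have hp := Int.prime_three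
  have hAC3 : 3 ∣ A ∧ 3 ∣ C := by
    rcases hp.dvd_or_dvd h with h | h
    · rcases hp.dvd_or_dvd h with h | h
      · rcases hp.dvd_or_dvd h with h | h
        · exact ⟨h, by omega⟩
        · omega
      · have := hp.dvd_of_dvd_pow h
        exact ⟨by omega, this⟩
    · exact absurd (hp.dvd_of_dvd_pow h) hD
  obtain ⟨⟨a, rfl⟩, ⟨c, rfl⟩⟩ := hAC3
  exact ⟨a * (x ^ 2 + y ^ 2) * c ^ 2 * D ^ 2, by ring⟩

theorem sq_sub_eisNorm {p u₁ u₂ : ℤ} (h : 3 ∣ p - u₁ - u₂) : 3 ∣ p ^ 2 - eisNorm u₁ u₂ := by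
  obtain ⟨k, hk⟩ := h
  obtain rfl : p = 3 * k + u₁ + u₂ := by linarith
  exact ⟨3 * k ^ 2 + 2 * k * (u₁ + u₂) + u₁ * u₂, by unfold eisNorm; ring⟩

/-- One of the odd part `B` of `x² + y²` and `D` is `2` modulo `3`, since `2 B` and `8 B` are both
congruent to `-B`; a prime factor `p ≡ 2` modulo `3` of that number yields `k`. -/
theorem exists_prime_factor {x y e B D : ℤ} (he : e = 2 ∨ e = 8) (hB : x ^ 2 + y ^ 2 = e * B)
    (hB2 : B % 2 = 1) (hD2 : D % 2 = 1) (hBD : 3 ∣ x ^ 2 + y ^ 2 - D) (hD3 : ¬ 3 ∣ D)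
    (hD : 0 ≤ D) :
    ∃ k : ℕ, ((k.Prime ∧ k % 12 = 5) ∨ ∃ p : ℕ, p.Prime ∧ p % 6 = 5 ∧ k = p ^ 2) ∧
      (k : ℤ) ∣ (x ^ 2 + y ^ 2) * D ^ 2 := by
  have hB0 : 0 ≤ B := by
    have := add_nonneg (sq_nonneg x) (sq_nonneg y)
    rcases he with rfl | rfl <;> omega
  have h3 : B % 3 = 2 ∨ D % 3 = 2 := by rcases he with rfl | rfl <;> omega
  rcases h3 with h | h
  · lift B to ℕ using hB0
    obtain ⟨p, hp, hpB, hp3⟩ := Nat.exists_prime_dvd_of_mod_three_eq_two (n := B) (by omega)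
    have hp2 : p % 2 = 1 := by
      by_contra h2
      have : 2 ∣ B := (Nat.dvd_of_mod_eq_zero (by omega : p % 2 = 0)).trans hpB
      omega
    have hpxy : (p : ℤ) ∣ x ^ 2 + y ^ 2 := hB ▸ (Int.natCast_dvd_natCast.2 hpB).mul_left e
    have h4 : p % 4 = 1 ∨ p % 4 = 3 := by omega
    rcases h4 with h4 | h4
    · exact ⟨p, .inl ⟨hp, by omega⟩, hpxy.mul_right _⟩
    · refine ⟨p ^ 2, .inr ⟨p, hp, by omega, rfl⟩, ?_⟩
      push_cast
      exact (sq_dvd_sq_add_sq hp h4 hpxy).mul_right _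
  · lift D to ℕ using hD
    obtain ⟨p, hp, hpD, hp3⟩ := Nat.exists_prime_dvd_of_mod_three_eq_two (n := D) (by omega)
    have hp2 : p % 2 = 1 := by
      by_contra h2
      have : 2 ∣ D := (Nat.dvd_of_mod_eq_zero (by omega : p % 2 = 0)).trans hpD
      omega
    refine ⟨p ^ 2, .inr ⟨p, hp, by omega, rfl⟩, ?_⟩
    push_cast
    exact (pow_dvd_pow_of_dvd (Int.natCast_dvd_natCast.2 hpD) 2).mul_left _

/-- The numbers `k` in the third family are coprime to `6`. -/
theorem isCoprime_six_of_special {k : ℕ}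
    (hk : (k.Prime ∧ k % 12 = 5) ∨ ∃ p : ℕ, p.Prime ∧ p % 6 = 5 ∧ k = p ^ 2) :
    IsCoprime (k : ℤ) 6 := by
  rcases hk with ⟨-, h⟩ | ⟨p, -, h, rfl⟩
  · exact isCoprime_six_iff.2 (by omega)
  · push_cast
    exact (isCoprime_six_iff.2 (by omega)).pow_left

theorem exists_eq_two_pow_mul_three_pow_mul {M : ℤ} (hM : M ≠ 0) :
    ∃ (a b : ℕ) (m : ℤ), IsCoprime m 6 ∧ M = 2 ^ a * 3 ^ b * m := by
  obtain ⟨c, hc, hc2⟩ := (Int.finiteMultiplicity_iff.2 ⟨by norm_num, hM⟩ :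
    FiniteMultiplicity 2 M).exists_eq_pow_mul_and_not_dvd
  have hc0 : c ≠ 0 := by rintro rfl; simp at hc2
  obtain ⟨m, hm, hm3⟩ := (Int.finiteMultiplicity_iff.2 ⟨by norm_num, hc0⟩ :
    FiniteMultiplicity 3 c).exists_eq_pow_mul_and_not_dvd
  refine ⟨multiplicity 2 M, multiplicity 3 c, m, isCoprime_six_iff.2 ⟨fun h => hc2 ?_, hm3⟩, ?_⟩
  · rw [hm]; exact h.mul_left _
  · rw [mul_assoc, ← hm, ← hc]

theorem pow_dvd_iff_le_of_not_dvd {p : ℤ} (hp : Prime p) {n a : ℕ} {c : ℤ} (hc : ¬ p ∣ c) :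
    p ^ n ∣ p ^ a * c ↔ n ≤ a :=
  ⟨fun h => (pow_dvd_pow_iff hp.ne_zero hp.not_isUnit).1
    ((hp.coprime_iff_not_dvd.2 hc).pow_left.dvd_of_dvd_mul_right h),
    fun h => (pow_dvd_pow p h).mul_right c⟩

theorem theorem5p1 :
    integerGroupDets (QuaternionGroup 3) =
      {0} ∪
      {M : ℤ | ∃ (a b : ℕ) (m : ℤ), IsCoprime m 6 ∧
        (a = 0 ∨ a = 4 ∨ 6 ≤ a) ∧ (b = 0 ∨ 3 ≤ b) ∧ M = 2 ^ a * 3 ^ b * m} ∪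
      {M : ℤ | ∃ (b : ℕ) (m : ℤ), IsCoprime m 6 ∧
        (b = 4 ∨ 6 ≤ b) ∧ M = 2 ^ 5 * 3 ^ b * m} ∪
      {M : ℤ | ∃ (b : ℕ) (m : ℤ) (k : ℕ), IsCoprime m 6 ∧
        (b = 0 ∨ b = 3 ∨ b = 5) ∧
        ((k.Prime ∧ k % 12 = 5) ∨ (∃ p : ℕ, p.Prime ∧ p % 6 = 5 ∧ k = p ^ 2)) ∧
        M = 2 ^ 5 * 3 ^ b * m * k} := by
  apply Set.Subset.antisymm
  · intro M hM
    rcases eq_or_ne M 0 with rfl | hM0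
    · exact .inl (.inl (.inl rfl))
    obtain ⟨a, b, m, hm, hMabm⟩ := exists_eq_two_pow_mul_three_pow_mul hM0
    have hm' := isCoprime_six_iff.1 hm
    have h2M : ∀ n, 2 ^ n ∣ M ↔ n ≤ a := fun n => by
      rw [hMabm, mul_assoc]
      refine pow_dvd_iff_le_of_not_dvd Int.prime_two fun h => ?_
      rcases Int.prime_two.dvd_or_dvd h with h | h
      · have := Int.prime_two.dvd_of_dvd_pow h; omega
      · exact hm'.1 h
    have h3M : ∀ n, 3 ^ n ∣ M ↔ n ≤ b := fun n => by
      rw [hMabm, mul_comm (2 ^ a), mul_assoc]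
      refine pow_dvd_iff_le_of_not_dvd Int.prime_three fun h => ?_
      rcases Int.prime_three.dvd_or_dvd h with h | h
      · have := Int.prime_three.dvd_of_dvd_pow h; omega
      · exact hm'.2 h
    obtain ⟨p, p', u₁, u₂, v₁, v₂, q, q', w₁, w₂, z₁, z₂, ⟨hp, hu₁, hu₂, hpu, hpv⟩,
      ⟨hq, hw₁, hw₂, hqw, hqz⟩, hMeq⟩ := mem_dets_iff.1 hM
    have hCD : (eisNorm u₁ u₂ - eisNorm w₁ w₂) % 2 = (eisNorm v₁ v₂ + eisNorm z₁ z₂) % 2 := by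
      have h₁ := eisNorm_emod_two u₁ u₂
      have h₂ := eisNorm_emod_two v₁ v₂
      have h₃ := eisNorm_emod_two w₁ w₂
      have h₄ := eisNorm_emod_two z₁ z₂
      omega
    have hAC : 3 ∣ p ^ 2 - q ^ 2 - (eisNorm u₁ u₂ - eisNorm w₁ w₂) := by
      have h₁ := sq_sub_eisNorm hpu
      have h₂ := sq_sub_eisNorm hqw
      omega
    have hBD : 3 ∣ p' ^ 2 + q' ^ 2 - (eisNorm v₁ v₂ + eisNorm z₁ z₂) := by
      have h₁ := sq_sub_eisNorm hpv
      have h₂ := sq_sub_eisNorm hqz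
      omega
    obtain ⟨t₁, t₂⟩ := two_adic hCD (linear_parity hp hq)
    obtain ⟨t₃, t₄⟩ := three_adic hAC hBD
    rw [← hMeq] at t₁ t₂ t₃ t₄
    rw [← pow_one 2, h2M, pow_one, h2M] at t₁
    rw [h2M, h2M] at t₂
    rw [← pow_one 3, h3M, pow_one, h3M] at t₃
    rw [h3M, h3M, h3M] at t₄
    by_cases ha : a = 5
    · subst ha
      by_cases hb : b = 4 ∨ 6 ≤ b
      · exact .inl (.inr ⟨b, m, hm, hb, hMabm⟩)
      obtain ⟨hD2, e, B, he, hB, hB2⟩ := (t₂ le_rfl).resolve_left (by norm_num)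
      obtain ⟨k, hk, hkd⟩ := exists_prime_factor he hB hB2 hD2 hBD (fun h => by
        have := t₄ h; omega) (add_nonneg (eisNorm_nonneg _ _) (eisNorm_nonneg _ _))
      have hk6 := isCoprime_six_of_special hk
      have hkM : (k : ℤ) ∣ 2 ^ 5 * 3 ^ b * m := by
        rw [← hMabm, hMeq]
        refine hkd.trans ⟨(p ^ 2 - q ^ 2) * (eisNorm u₁ u₂ - eisNorm w₁ w₂) ^ 2, by ring⟩
      have hk2 : IsCoprime (k : ℤ) 2 := hk6.of_isCoprime_of_dvd_right ⟨3, by norm_num⟩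
      have hk3 : IsCoprime (k : ℤ) 3 := hk6.of_isCoprime_of_dvd_right ⟨2, by norm_num⟩
      obtain ⟨m', rfl⟩ := (hk2.pow_right.mul_right hk3.pow_right).dvd_of_dvd_mul_left hkM
      have hb' : b = 0 ∨ b = 3 ∨ b = 5 := by clear * - hb t₃; omega
      exact .inr ⟨b, m', k, hm.of_mul_left_right, hb', hk, by rw [hMabm]; ring⟩
    · have ha' : a = 0 ∨ a = 4 ∨ 6 ≤ a := by clear * - ha t₁; omega
      have hb' : b = 0 ∨ 3 ≤ b := by clear * - t₃; omega
      exact .inl (.inl (.inr ⟨a, b, m, hm, ha', hb', hMabm⟩))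
  · rintro M (((rfl | ⟨a, b, m, hm, ha, hb, rfl⟩) | ⟨b, m, hm, hb, rfl⟩) |
      ⟨b, m, k, hm, hb, hk, rfl⟩)
    · exact mem_dets_of_eval (p := 0) (p' := 0) (u₁ := 0) (u₂ := 0) (v₁ := 0) (v₂ := 0)
        (q := 0) (q' := 0) (w₁ := 0) (w₂ := 0) (z₁ := 0) (z₂ := 0)
        (by norm_num [IsEvalData]) (by norm_num [IsEvalData]) (by norm_num [eisNorm])
    · exact mul_mem_integerGroupDets (mul_mem_integerGroupDets (two_pow_mem ha)
        (three_pow_mem hb)) (mem_dets_of_isCoprime_six hm)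
    · exact mul_mem_integerGroupDets (thirtyTwo_mul_three_pow_mem hb)
        (mem_dets_of_isCoprime_six hm)
    · have h : (2 : ℤ) ^ 5 * k ∈ S₁₂ := by
        rcases hk with ⟨hp, h5⟩ | ⟨p, hp, h5, rfl⟩
        · exact thirtyTwo_mul_prime_mem hp h5
        · simpa using thirtyTwo_mul_prime_sq_mem hp h5
      rw [show (2 : ℤ) ^ 5 * 3 ^ b * m * k = 2 ^ 5 * k * 3 ^ b * m by ring]
      exact mul_mem_integerGroupDets (mul_mem_integerGroupDets h (three_pow_mem (by omega)))
        (mem_dets_of_isCoprime_six hm)
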